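/- Let $D\ge 2$, let $\mathcal M$ be the set of real $D\times D$ matrices $M$ with largest singular value $\sigma_{\max}(M)=1$, and for real numbers $\lambda, L, U$ let $$\phi^\lambda_{L,U}(\rho,Y)=\begin{cases}\min\{1,\lambda\max\{0,\rho-U\}\} & \text{if } Y=1,\\ \min\{1,\lambda\max\{0,L-\rho\}\} & \text{if } Y=0.\end{cases}$$ For a probability distribution $\mathcal D$ on $\mathbb R^D\times\{0,1\}$ and $M\in\mathcal M$ put $$\mathrm{err}(M,\mathcal D)=\mathbb E_{(x_1,y_1),(x_2,y_2)\sim\mathcal D\text{ indep.}}\big[\phi^\lambda_{L,U}\big(\|M(x_1-x_2)\|^2,\mathbf 1[y_1=y_2]\big)\big],$$ and for a paired sample $S_m=\big(((x_{1,i},y_{1,i}),(x_{2,i},y_{2,i}))\big)_{i=1}^m$ put $$\mathrm{err}(M,S_m)=\frac1m\sum_{i=1}^m\phi^\lambda_{L,U}\big(\|M(x_{1,i}-x_{2,i})\|^2,\mathbf 1[y_{1,i}=y_{2,i}]\big).$$ There exist $\lambda\ge 0$ and $0\le U<L$, and a regular simplex in $\mathbb R^D$ whose $D+1$ vertices lie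 on the unit sphere, such that the following holds. Let $m$ be a sample size and let $\mathcal A$ be any algorithm that maps each paired sample $S_m$ of size $m$ to a matrix in $\mathcal M$ minimizing $\mathrm{err}(\cdot,S_m)$ over $\mathcal M$. Then for all $0<\epsilon,\delta<1/64$ there is a probability distribution $\mathcal D$ on $\mathbb R^D\times\{0,1\}$ of bounded support, with $x$-marginal supported on the vertices of the simplex, which has an optimal metric $M^*\in\operatorname{argmin}_{M\in\mathcal M}\mathrm{err}(M,\mathcal D)$ and is such that, if $m\le\frac{D+1}{512\,\epsilon^2}$, then $$\mathbf P_{S_m\sim(\mathcal D\times\mathcal D)^m}\Big[\mathrm{err}(\mathcal A(S_m),\mathcal D)-\mathrm{err}(M^*,\mathcal D)>\epsilon\Big]>\delta .$$ -/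

import Mathlib

open MeasureTheory

noncomputable section

namespace MetricLearning

/-- The representation space `ℝ^D` with its Euclidean norm. -/
abbrev Space (D : ℕ) : Type := EuclideanSpace ℝ (Fin D)

/-- A labelled observation `z = (x, y)` with `x ∈ ℝ^D` and `y ∈ {0, 1}`. -/
abbrev Obs (D : ℕ) : Type := Space D × Fin 2

/-- A pair `(z₁, z₂)` of labelled observations. -/
abbrev ObsPair (D : ℕ) : Type := Obs D × Obs D

/-- The largest singular value of a matrix, i.e. its operator norm for the Euclidean norm. -/
def sigmaMax {D : ℕ} (M : Matrix (Fin D) (Fin D) ℝ) : ℝ :=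
  ‖Matrix.toEuclideanCLM (n := Fin D) (𝕜 := ℝ) M‖

/-- The class of weighting metrics: all `D × D` real matrices with `σ_max(M) = 1`. -/
def metrics (D : ℕ) : Set (Matrix (Fin D) (Fin D) ℝ) :=
  {M | sigmaMax M = 1}

/-- The weighted distance `ρ_M(x₁, x₂) = ‖M (x₁ - x₂)‖²`. -/
def weightedDist {D : ℕ} (M : Matrix (Fin D) (Fin D) ℝ) (x₁ x₂ : Space D) : ℝ :=
  ‖Matrix.toEuclideanCLM (n := Fin D) (𝕜 := ℝ) M (x₁ - x₂)‖ ^ 2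

/-- The distance-based loss `φ^lam_{L,U}(ρ, Y)`: `min {1, lam [ρ - U]₊}` if `Y = 1`, and
`min {1, lam [L - ρ]₊}` otherwise. -/
def lossLU (lam L U ρ : ℝ) (Y : Bool) : ℝ :=
  if Y then min 1 (lam * max 0 (ρ - U)) else min 1 (lam * max 0 (L - ρ))

/-- The loss of the metric `M` on a pair of labelled observations, with `Y = 1[y₁ = y₂]`. -/
def pairLoss {D : ℕ} (lam L U : ℝ) (M : Matrix (Fin D) (Fin D) ℝ) (p : ObsPair D) : ℝ :=
  lossLU lam L U (weightedDist M p.1.1 p.2.1) (decide (p.1.2 = p.2.2))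

/-- The distance-based error `E_{z₁, z₂ ∼ 𝒟} φ(ρ_M(x₁, x₂), 1[y₁ = y₂])`, with `z₁, z₂`
independent. -/
def distErr {D : ℕ} (lam L U : ℝ) (M : Matrix (Fin D) (Fin D) ℝ) (𝒟 : Measure (Obs D)) : ℝ :=
  ∫ p, pairLoss lam L U M p ∂(𝒟.prod 𝒟)

/-- A paired sample of size `m`. -/
abbrev PairedSample (D m : ℕ) : Type := Fin m → ObsPair D

/-- The law of an i.i.d. paired sample of size `m` from `𝒟`. -/
def sampleLaw {D : ℕ} (m : ℕ) (𝒟 : Measure (Obs D)) : Measure (PairedSample D m) :=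
  Measure.pi fun _ => 𝒟.prod 𝒟

/-- The empirical error of the metric `M` on a paired sample of size `m`. -/
def empErr {D m : ℕ} (lam L U : ℝ) (M : Matrix (Fin D) (Fin D) ℝ) (S : PairedSample D m) : ℝ :=
  (1 / (m : ℝ)) * ∑ i, pairLoss lam L U M (S i)

/-- `A` is an algorithm which, on every paired sample of size `m`, returns a weighting metric
from the class that minimizes the empirical error. -/
def IsEmpiricalMinimizer {D m : ℕ} (lam L U : ℝ)
    (A : PairedSample D m → Matrix (Fin D) (Fin D) ℝ) : Prop :=
  ∀ S, A S ∈ metrics D ∧ ∀ M ∈ metrics D, empErr lam L U (A S) S ≤ empErr lam L U M S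

/-- `M` is an optimal metric for `𝒟`: a minimizer of the distance-based error over the class. -/
def IsOptimalMetric {D : ℕ} (lam L U : ℝ) (𝒟 : Measure (Obs D))
    (M : Matrix (Fin D) (Fin D) ℝ) : Prop :=
  M ∈ metrics D ∧ ∀ M' ∈ metrics D, distErr lam L U M 𝒟 ≤ distErr lam L U M' 𝒟

/-- `𝒟` has bounded support: for some `B`, almost surely `‖x‖ ≤ B`. -/
def HasBoundedSupport {D : ℕ} (𝒟 : Measure (Obs D)) : Prop :=
  ∃ B : ℝ, ∀ᵐ z ∂𝒟, ‖z.1‖ ≤ B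

end MetricLearning

end

/-!
The hard distributions live on a star. One vertex of the simplex, the anchor, has mass `2 / 3` and
always label `0`; `k = D - 1` further vertices, the sites, share the rest, and their labels are
fair up to a bias `α = 9 ε` whose sign `b i` is free; the last vertex has mass `0`.

* *The Bayes metric is in the class.* For each sign pattern `b`, the sites of the anchor's side and
  the other sites span disjoint proper faces of the simplex, because of the massless vertex. The
  rank-one metric along the line through the centroids of a face and its opposite face collapses
  both and separates them by at least `4 / D` (`exists_separating_metric`). With `U = 0`,
  `L = 4 / D` and `lam L = 2`, it is Bayes optimal on all pairs at once
  (`starErr_eq_starBayesErr`).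
* *Errors are costly.* Comparing the distance from the anchor to site `i` with `L / 2`, every metric
  predicts a sign for `i`, since the loss is `1` for one of the two values of `Y`. Each wrong sign
  costs `α` on the pairs of the site and the anchor, that is `4 ε / k` in total
  (`le_starErr_sub`), so more than `k / 4` wrong signs cost more than `ε`.
* *Signs are hard to learn.* The laws of the sample for two patterns that differ in one sign have
  squared Bhattacharyya affinity at least `1 - 4 m (1 - √(1 - α²)) / (3 k)`, hence overlap, and
  averaging over all patterns gives one for which many signs are wrong on average
  (`exists_le_expected_errors`). Markov's inequality turns this into a probability of at least
  `1 / 64` (`exists_le_prob_errors`).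

The algorithm need not be measurable: the laws have finite support, so the probability of an
arbitrary set of samples is bounded below by a finite sum (`le_sampleLaw_toMeasure_map`).
-/

namespace MetricLearning

/-! ### Affinity and the error of testing a sign -/

/-- The Bhattacharyya affinity `∑ √(p q)` of two mass functions on a finite type. -/
noncomputable def affinity {Ω : Type*} [Fintype Ω] (p q : Ω → ℝ) : ℝ := ∑ ω, √(p ω * q ω)

lemma affinity_prod {Ω Ω' : Type*} [Fintype Ω] [Fintype Ω'] {p q : Ω → ℝ} {p' q' : Ω' → ℝ}
    (hp : ∀ ω, 0 ≤ p ω) (hq : ∀ ω, 0 ≤ q ω) :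
    affinity (fun z : Ω × Ω' => p z.1 * p' z.2) (fun z => q z.1 * q' z.2)
      = affinity p q * affinity p' q' := by
  simp only [affinity, Finset.sum_mul_sum, Fintype.sum_prod_type]
  refine Finset.sum_congr rfl fun x _ => Finset.sum_congr rfl fun y _ => ?_
  rw [← Real.sqrt_mul (mul_nonneg (hp x) (hq x))]
  congr 1
  ring

lemma affinity_pi {Ω : Type*} [Fintype Ω] {p q : Ω → ℝ} (hp : ∀ ω, 0 ≤ p ω)
    (hq : ∀ ω, 0 ≤ q ω) (m : ℕ) :
    affinity (fun S : Fin m → Ω => ∏ j, p (S j)) (fun S => ∏ j, q (S j))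
      = affinity p q ^ m := by
  classical
  simp only [affinity]
  rw [← Fintype.card_fin m, ← Finset.card_univ, ← Finset.prod_const, Finset.prod_univ_sum,
    Finset.card_univ, Fintype.card_fin, Fintype.piFinset_univ]
  refine Finset.sum_congr rfl fun S _ => ?_
  rw [← Finset.prod_mul_distrib, Real.sqrt_prod _ fun j _ => mul_nonneg (hp _) (hq _)]

/-- Two probability mass functions with large affinity overlap: Cauchy–Schwarz for
`√(p q) = √(min p q) √(max p q)`. -/
lemma one_sub_le_sum_min {Ω : Type*} [Fintype Ω] {p q : Ω → ℝ} {τ : ℝ} (hτ : 0 ≤ τ)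
    (hp : ∀ ω, 0 ≤ p ω) (hq : ∀ ω, 0 ≤ q ω) (hp1 : ∑ ω, p ω = 1) (hq1 : ∑ ω, q ω = 1)
    (h : 1 - τ ^ 2 ≤ affinity p q ^ 2) : 1 - τ ≤ ∑ ω, min (p ω) (q ω) := by
  have hmax : ∑ ω, max (p ω) (q ω) = 2 - ∑ ω, min (p ω) (q ω) := by
    rw [eq_sub_iff_add_eq, ← Finset.sum_add_distrib]
    simp only [max_add_min, Finset.sum_add_distrib, hp1, hq1]
    norm_num
  have hcs : affinity p q ^ 2 ≤ (∑ ω, min (p ω) (q ω)) * ∑ ω, max (p ω) (q ω) := by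
    have := Finset.sum_mul_sq_le_sq_mul_sq Finset.univ (fun ω => √(min (p ω) (q ω)))
      (fun ω => √(max (p ω) (q ω)))
    simp only [Real.sq_sqrt (le_min (hp _) (hq _)),
      Real.sq_sqrt ((hp _).trans (le_max_left _ _)),
      ← Real.sqrt_mul (le_min (hp _) (hq _)), min_mul_max] at this
    exact this
  rw [hmax] at hcs
  by_contra! hlt
  nlinarith

/-- Assouad's averaging argument. If each law `P b` in a family indexed by sign patterns has
affinity at least `√(1 - τ²)` with each of its neighbours, then every predictor `g` of the pattern
errs in at least `k (1 - τ) / 2` coordinates on average, for some pattern. -/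
lemma exists_le_expected_errors {Ω : Type*} [Fintype Ω] {k : ℕ} {P : (Fin k → Bool) → Ω → ℝ}
    {τ : ℝ} (hτ : 0 ≤ τ) (hP : ∀ b ω, 0 ≤ P b ω) (hP1 : ∀ b, ∑ ω, P b ω = 1)
    (h : ∀ b i, 1 - τ ^ 2 ≤ affinity (P b) (P (Function.update b i (!b i))) ^ 2)
    (g : Ω → Fin k → Bool) :
    ∃ b, k * ((1 - τ) / 2) ≤ ∑ ω, P b ω * (Finset.univ.filter fun i => g ω i ≠ b i).card := by
  have key (i : Fin k) : ∑ _b : Fin k → Bool, (1 - τ) / 2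
      ≤ ∑ b : Fin k → Bool, ∑ ω, P b ω * (if g ω i ≠ b i then 1 else 0) := by
    have hinv : Function.Involutive fun b : Fin k → Bool => Function.update b i (!b i) := by
      intro b
      simp
    have hflip := (Equiv.sum_comp hinv.toPerm
      fun b => ∑ ω, P b ω * (if g ω i ≠ b i then (1 : ℝ) else 0)).symm
    rw [← add_self_div_two (∑ b : Fin k → Bool, ∑ ω, _)]
    nth_rewrite 2 [hflip]
    rw [← Finset.sum_div, ← Finset.sum_add_distrib]
    refine div_le_div_of_nonneg_right (Finset.sum_le_sum fun b _ => ?_) zero_le_two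
    refine (one_sub_le_sum_min hτ (hP b) (hP _) (hP1 b) (hP1 _) (h b i)).trans ?_
    rw [← Finset.sum_add_distrib]
    refine Finset.sum_le_sum fun ω _ => ?_
    simp only [Function.Involutive.coe_toPerm, Function.update_self]
    by_cases hg : g ω i = b i
    · simp [hg]
    · simp [show g ω i = !b i by simpa [Bool.eq_not] using hg]
  by_contra! hlt
  have h1 := Finset.sum_lt_sum_of_nonempty (Finset.univ_nonempty) fun b _ => hlt b
  have h2 := Finset.sum_le_sum fun i (_ : i ∈ Finset.univ) => key i
  rw [Finset.sum_comm, Finset.sum_comm (s := Finset.univ (α := Fin k))] at h2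
  refine absurd h1 (not_lt.2 (le_of_eq_of_le ?_ (h2.trans_eq ?_)))
  · simp
  · refine Finset.sum_congr rfl fun b _ => ?_
    rw [Finset.sum_comm]
    refine Finset.sum_congr rfl fun ω _ => ?_
    rw [← Finset.mul_sum, Finset.sum_boole]

/-! ### The regular simplex and the metrics that collapse two opposite faces -/

lemma dist_sq_of_inner_eq {D : ℕ} {x : Fin (D + 1) → Space D}
    (hx : ∀ i j, inner ℝ (x i) (x j) = if i = j then 1 else -1 / (D : ℝ)) {i j : Fin (D + 1)}
    (hij : i ≠ j) : dist (x i) (x j) ^ 2 = 2 + 2 / D := by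
  rw [dist_eq_norm, norm_sub_sq_real, ← real_inner_self_eq_norm_sq, ← real_inner_self_eq_norm_sq,
    hx, hx, hx, if_neg hij, if_pos rfl, if_pos rfl]
  ring

lemma affineIndependent_of_inner_eq {D : ℕ} {x : Fin (D + 1) → Space D}
    (hx : ∀ i j, inner ℝ (x i) (x j) = if i = j then 1 else -1 / (D : ℝ)) :
    AffineIndependent ℝ x := by
  rw [affineIndependent_iff]
  intro s w hw hsum i hi
  have h := congrArg (fun v => inner ℝ v (x i)) hsum
  have hterm : ∀ j ∈ s, w j * inner ℝ (x j) (x i)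
      = (if j = i then w j * (1 + 1 / (D : ℝ)) else 0) + w j * (-1 / (D : ℝ)) := by
    intro j _
    rw [hx]
    split_ifs <;> ring
  simp only [sum_inner, real_inner_smul_left, inner_zero_left] at h
  rw [Finset.sum_congr rfl hterm, Finset.sum_add_distrib, ← Finset.sum_mul, hw,
    Finset.sum_ite_eq' s i, if_pos hi, zero_mul, add_zero] at h
  have : (1 : ℝ) + 1 / (D : ℝ) ≠ 0 := by positivity
  exact (mul_eq_zero.1 h).resolve_right this

/-- Unit vectors with the Gram matrix of a regular simplex: `√(1 + 1/D) eᵢ + r 𝟙` for a suitable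
`r`, and `-𝟙 / √D`. -/
lemma exists_inner_eq (D : ℕ) (hD : 0 < D) : ∃ x : Fin (D + 1) → Space D,
    ∀ i j, inner ℝ (x i) (x j) = if i = j then 1 else -1 / (D : ℝ) := by
  have hD0 : (0 : ℝ) < D := by exact_mod_cast hD
  obtain ⟨a, ha, ha2⟩ : ∃ a : ℝ, 0 < a ∧ a ^ 2 = D := ⟨√D, by positivity, Real.sq_sqrt hD0.le⟩
  obtain ⟨s, hs2⟩ : ∃ s : ℝ, s ^ 2 = 1 + 1 / D := ⟨√(1 + 1 / D), Real.sq_sqrt (by positivity)⟩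
  have hainv : (1 / a) ^ 2 = 1 / (D : ℝ) := by rw [div_pow, ha2, one_pow]
  obtain ⟨r, hr⟩ : ∃ r : ℝ, s + D * r = 1 / a := ⟨(1 / a - s) / D, by field_simp; ring⟩
  have hr2 : 2 * s * r + D * r ^ 2 = -1 / (D : ℝ) := by
    have h1 : D * (2 * s * r + D * r ^ 2) = (s + D * r) ^ 2 - s ^ 2 := by ring
    rw [hr, hainv, hs2] at h1
    rw [eq_div_iff hD0.ne', mul_comm, h1]
    ring
  let e : Fin D → Space D := fun i => EuclideanSpace.single i (1 : ℝ)
  let o : Space D := WithLp.toLp 2 fun _ => (1 : ℝ)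
  have hee (i j) : inner ℝ (e i) (e j) = if i = j then (1 : ℝ) else 0 := by
    simp [e, EuclideanSpace.inner_single_left]
  have heo (i) : inner ℝ (e i) o = 1 := by simp [e, o, EuclideanSpace.inner_single_left]
  have hoe (i) : inner ℝ o (e i) = 1 := by rw [real_inner_comm, heo]
  have hoo : inner ℝ o o = (D : ℝ) := by
    simp [o, -inner_self_eq_norm_sq_to_K, PiLp.inner_apply]
  refine ⟨Fin.lastCases (-(1 / a) • o) fun i => s • e i + r • o, fun i j => ?_⟩
  induction i using Fin.lastCases with
  | last =>
    induction j using Fin.lastCases with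
    | last =>
      simp only [Fin.lastCases_last, real_inner_smul_left, real_inner_smul_right, hoo, if_pos]
      calc -(1 / a) * (-(1 / a) * D) = (1 / a) ^ 2 * D := by ring
        _ = 1 := by rw [hainv]; field_simp
    | cast j =>
      simp only [Fin.lastCases_last, Fin.lastCases_castSucc, real_inner_smul_left,
        inner_add_right, real_inner_smul_right, hoo, hoe, (Fin.castSucc_lt_last j).ne', if_false]
      calc _ = -((1 / a) * (s + D * r)) := by ring
        _ = -1 / D := by rw [hr, ← sq, hainv]; ring
  | cast i =>
    induction j using Fin.lastCases with
    | last =>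
      simp only [Fin.lastCases_last, Fin.lastCases_castSucc, real_inner_smul_left,
        inner_add_left, real_inner_smul_right, hoo, heo, (Fin.castSucc_lt_last i).ne, if_false]
      calc _ = -((1 / a) * (s + D * r)) := by ring
        _ = -1 / D := by rw [hr, ← sq, hainv]; ring
    | cast j =>
      simp only [Fin.lastCases_castSucc, real_inner_smul_left, inner_add_left, inner_add_right,
        real_inner_smul_right, hoo, heo, hoe, hee, Fin.castSucc_inj]
      split_ifs with hij
      · calc _ = s ^ 2 + (2 * s * r + D * r ^ 2) := by ring
          _ = 1 := by rw [hs2, hr2]; ring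
      · calc _ = 2 * s * r + D * r ^ 2 := by ring
          _ = -1 / D := hr2

/-- For a proper nonempty set `G` of vertices of the regular simplex, the rank-one metric along
the line joining the centroids of the faces `G` and `Gᶜ` collapses each of these two faces and
puts distance at least `4 / D` between them. -/
lemma exists_separating_metric {D : ℕ} (hD : 0 < D) {x : Fin (D + 1) → Space D}
    (hx : ∀ i j, inner ℝ (x i) (x j) = if i = j then 1 else -1 / (D : ℝ))
    {G : Finset (Fin (D + 1))} (hG : G.Nonempty) (hG' : G ≠ Finset.univ) :
    ∃ M ∈ metrics D, (∀ i j, (i ∈ G ↔ j ∈ G) → weightedDist M (x i) (x j) = 0) ∧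
      ∀ i j, ¬ (i ∈ G ↔ j ∈ G) → 4 / (D : ℝ) ≤ weightedDist M (x i) (x j) := by
  have hD0 : (0 : ℝ) < D := by exact_mod_cast hD
  set s : Space D := ∑ i ∈ G, x i with hs
  set a : ℝ := (G.card : ℝ) with ha
  have ha0 : 0 < a := by simpa [ha] using hG
  have haD : a < D + 1 := by
    have := (Finset.card_lt_univ_of_notMem (s := G)
      (Classical.choose_spec (not_forall.1 (mt Finset.eq_univ_iff_forall.2 hG'))))
    rw [Fintype.card_fin] at this
    rw [ha]
    exact_mod_cast this
  have hsx (j) : inner ℝ s (x j) = (if j ∈ G then (D + 1) / (D : ℝ) else 0) - a / D := by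
    have hterm (i) : inner ℝ (x i) (x j) = (if i = j then (D + 1) / (D : ℝ) else 0) + -1 / D := by
      rw [hx]
      split_ifs
      · field_simp
        ring
      · ring
    rw [hs, sum_inner, Finset.sum_congr rfl fun i _ => hterm i, Finset.sum_add_distrib,
      Finset.sum_ite_eq' G j, Finset.sum_const, nsmul_eq_mul]
    ring
  have hss : ‖s‖ ^ 2 = a * (D + 1 - a) / D := by
    rw [← real_inner_self_eq_norm_sq]
    nth_rewrite 2 [hs]
    rw [inner_sum, Finset.sum_congr rfl fun j hj => (hsx j).trans (by rw [if_pos hj]),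
      Finset.sum_const, nsmul_eq_mul]
    ring
  have hs0 : 0 < ‖s‖ ^ 2 := by
    rw [hss]
    have : 0 < D + 1 - a := by linarith
    positivity
  have hsn : ‖s‖ ≠ 0 := fun h => by simp [h] at hs0
  set u : Space D := ‖s‖⁻¹ • s with hu
  have hu1 : ‖u‖ = 1 := by simp [hu, norm_smul, hsn]
  have hdist (i j) : weightedDist ((Matrix.toEuclideanCLM (n := Fin D) (𝕜 := ℝ)).symm
      (InnerProductSpace.rankOne ℝ u u))
      (x i) (x j) = (inner ℝ s (x i) - inner ℝ s (x j)) ^ 2 / ‖s‖ ^ 2 := by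
    rw [weightedDist, StarAlgEquiv.apply_symm_apply, InnerProductSpace.rankOne_apply, norm_smul,
      hu1, mul_one, Real.norm_eq_abs, sq_abs, hu, real_inner_smul_left, inner_sub_right, mul_pow,
      inv_pow, div_eq_inv_mul]
  refine ⟨(Matrix.toEuclideanCLM (n := Fin D) (𝕜 := ℝ)).symm (InnerProductSpace.rankOne ℝ u u),
    ?_, fun i j hij => ?_, fun i j hij => ?_⟩
  · change ‖_‖ = 1
    rw [StarAlgEquiv.apply_symm_apply, InnerProductSpace.norm_rankOne, hu1, mul_one]
  · rw [hdist, hsx, hsx]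
    simp [hij]
  · have hsq : (inner ℝ s (x i) - inner ℝ s (x j)) ^ 2 = ((D + 1) / (D : ℝ)) ^ 2 := by
      rw [hsx, hsx]
      by_cases hi : i ∈ G <;> by_cases hj : j ∈ G <;> simp [hi, hj] at hij ⊢
      ring
    rw [hdist, hsq, le_div_iff₀ hs0, hss, div_mul_div_comm, div_pow, ← sq]
    gcongr
    -- `4 a (D + 1 - a) ≤ (D + 1)²`
    nlinarith [sq_nonneg (2 * a - (D + 1))]

/-! ### The noisy star: an anchor with a certain label and `k` sites with biased labels -/

/-- The sign of a label: `1` for the label `0` and `-1` for the label `1`. -/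
def labelSign (y : Fin 2) : ℝ := if y = 0 then 1 else -1

/-- The mean label sign at each site: the anchor `none` always has label `0`, and the label of
`some i` is biased by `α` towards the side given by `b i`. -/
def labelMean {k : ℕ} (α : ℝ) (b : Fin k → Bool) : Option (Fin k) → ℝ
  | none => 1
  | some i => if b i then α else -α

/-- The mass of each site: `2 / 3` for the anchor, the rest shared equally. The weight `2 / 3`
maximizes `p² (1 - p)`, to which the guaranteed squared excess error at given information is
proportional. -/
noncomputable def siteMass (k : ℕ) : Option (Fin k) → ℝ
  | none => 2 / 3
  | some _ => 1 / (3 * k)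

/-- The probability mass of a labelled site. -/
noncomputable def obsMass {k : ℕ} (α : ℝ) (b : Fin k → Bool) (z : Option (Fin k) × Fin 2) : ℝ :=
  siteMass k z.1 * ((1 + labelMean α b z.1 * labelSign z.2) / 2)

/-- The probability mass of an independent pair of labelled sites. -/
noncomputable def pairMass {k : ℕ} (α : ℝ) (b : Fin k → Bool)
    (p : (Option (Fin k) × Fin 2) × (Option (Fin k) × Fin 2)) : ℝ :=
  obsMass α b p.1 * obsMass α b p.2

/-- The probability mass of a paired sample of labelled sites. -/
noncomputable def sampleMass {k m : ℕ} (α : ℝ) (b : Fin k → Bool)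
    (S : Fin m → (Option (Fin k) × Fin 2) × (Option (Fin k) × Fin 2)) : ℝ :=
  ∏ j, pairMass α b (S j)

section Mass

variable {k : ℕ} {α : ℝ}

lemma siteMass_nonneg (v : Option (Fin k)) : 0 ≤ siteMass k v := by
  cases v <;> simp only [siteMass] <;> positivity

lemma sum_siteMass (hk : 0 < k) : ∑ v, siteMass k v = 1 := by
  have : (0 : ℝ) < k := by exact_mod_cast hk
  simp only [Fintype.sum_option, siteMass, Finset.sum_const, Finset.card_univ, Fintype.card_fin,
    nsmul_eq_mul]
  field_simp
  norm_num

lemma abs_labelMean_le (hα0 : 0 ≤ α) (hα1 : α ≤ 1) (b : Fin k → Bool) (v : Option (Fin k)) :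
    |labelMean α b v| ≤ 1 := by
  rcases v with _ | i
  · simp [labelMean]
  · simp only [labelMean]
    split_ifs <;> simpa [abs_of_nonneg hα0] using hα1

lemma obsMass_nonneg (hα0 : 0 ≤ α) (hα1 : α ≤ 1) (b : Fin k → Bool)
    (z : Option (Fin k) × Fin 2) : 0 ≤ obsMass α b z := by
  have h := abs_le.1 (abs_labelMean_le hα0 hα1 b z.1)
  refine mul_nonneg (siteMass_nonneg _) (div_nonneg ?_ zero_le_two)
  unfold labelSign
  split_ifs <;> linarith [h.1, h.2]

lemma sum_obsMass (hk : 0 < k) (b : Fin k → Bool) : ∑ z, obsMass α b z = 1 := by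
  rw [← sum_siteMass hk, Fintype.sum_prod_type]
  refine Finset.sum_congr rfl fun v _ => ?_
  simp only [obsMass, labelSign, Fin.sum_univ_two, if_pos, one_ne_zero, if_false]
  ring

lemma pairMass_nonneg (hα0 : 0 ≤ α) (hα1 : α ≤ 1) (b : Fin k → Bool)
    (p : (Option (Fin k) × Fin 2) × (Option (Fin k) × Fin 2)) : 0 ≤ pairMass α b p :=
  mul_nonneg (obsMass_nonneg hα0 hα1 b _) (obsMass_nonneg hα0 hα1 b _)

lemma sum_pairMass (hk : 0 < k) (b : Fin k → Bool) : ∑ p, pairMass α b p = 1 := by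
  simp only [pairMass, Fintype.sum_prod_type (f := fun p => obsMass α b p.1 * obsMass α b p.2),
    ← Finset.mul_sum, sum_obsMass hk, mul_one]

lemma sampleMass_nonneg (hα0 : 0 ≤ α) (hα1 : α ≤ 1) {m : ℕ} (b : Fin k → Bool)
    (S : Fin m → (Option (Fin k) × Fin 2) × (Option (Fin k) × Fin 2)) : 0 ≤ sampleMass α b S :=
  Finset.prod_nonneg fun _ _ => pairMass_nonneg hα0 hα1 b _

lemma sum_sampleMass (hk : 0 < k) (m : ℕ) (b : Fin k → Bool) :
    ∑ S : Fin m → _, sampleMass α b S = 1 := by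
  classical
  have h := (Finset.prod_univ_sum (fun _ : Fin m => Finset.univ)
    fun _ => pairMass (k := k) α b).symm
  rw [Fintype.piFinset_univ] at h
  simp only [sampleMass, h, sum_pairMass hk, Finset.prod_const_one]

lemma affinity_obsMass (hα0 : 0 ≤ α) (hα1 : α ≤ 1) (hk : 0 < k) (b : Fin k → Bool) (i : Fin k) :
    affinity (obsMass α b) (obsMass α (Function.update b i (!b i)))
      = 1 - 1 / (3 * k) * (1 - √(1 - α ^ 2)) := by
  have hsite (v : Option (Fin k)) :
      ∑ y, √(obsMass α b (v, y) * obsMass α (Function.update b i (!b i)) (v, y))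
        = siteMass k v - if v = some i then 1 / (3 * k) * (1 - √(1 - α ^ 2)) else 0 := by
    by_cases hv : v = some i
    · subst hv
      have hprod (y : Fin 2) :
          obsMass α b (some i, y) * obsMass α (Function.update b i (!b i)) (some i, y)
            = (1 / (6 * k)) ^ 2 * (1 - α ^ 2) := by
        simp only [obsMass, labelMean, siteMass, labelSign, Function.update_self]
        cases b i <;> fin_cases y <;> simp <;> ring
      simp only [hprod, if_pos, siteMass, Finset.sum_const, Finset.card_univ, Fintype.card_fin,
        nsmul_eq_mul, Real.sqrt_mul (sq_nonneg (1 / (6 * (k : ℝ)))),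
        Real.sqrt_sq (show (0 : ℝ) ≤ 1 / (6 * k) by positivity)]
      push_cast
      field_simp
      ring
    · have hsame (y : Fin 2) :
          obsMass α (Function.update b i (!b i)) (v, y) = obsMass α b (v, y) := by
        rcases v with _ | j
        · rfl
        · have hj : j ≠ i := fun h => hv (h ▸ rfl)
          simp [obsMass, labelMean, hj]
      simp only [hsame, Real.sqrt_mul_self (obsMass_nonneg hα0 hα1 b _), if_neg hv, sub_zero]
      simp only [obsMass, labelSign, Fin.sum_univ_two, if_pos, one_ne_zero, if_false]
      ring
  rw [affinity, Fintype.sum_prod_type, Finset.sum_congr rfl fun v _ => hsite v,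
    Finset.sum_sub_distrib, sum_siteMass hk, Finset.sum_ite_eq' Finset.univ (some i),
    if_pos (Finset.mem_univ _)]

/-- A paired sample of size `m` consists of `2 m` labelled sites, and each carries little
information on a given sign: Bernoulli's inequality for the product affinity. -/
lemma le_affinity_sampleMass_sq (hα0 : 0 ≤ α) (hα1 : α ≤ 1) (hk : 0 < k) (m : ℕ)
    (b : Fin k → Bool) (i : Fin k) :
    1 - 4 * m * (1 / (3 * k) * (1 - √(1 - α ^ 2)))
      ≤ affinity (sampleMass (m := m) α b) (sampleMass α (Function.update b i (!b i))) ^ 2 := by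
  have hk1 : (1 : ℝ) ≤ k := by exact_mod_cast hk
  have hx : 1 / (3 * k) * (1 - √(1 - α ^ 2)) ≤ 1 := by
    have h1 : 1 / (3 * (k : ℝ)) ≤ 1 := by
      rw [div_le_one (by positivity)]
      linarith
    have h2 : 1 - √(1 - α ^ 2) ≤ 1 := by linarith [Real.sqrt_nonneg (1 - α ^ 2)]
    calc _ ≤ 1 / (3 * (k : ℝ)) * 1 := by gcongr
      _ ≤ 1 := by linarith
  have haff : affinity (sampleMass (m := m) α b) (sampleMass α (Function.update b i (!b i))) ^ 2
      = (1 + -(1 / (3 * k) * (1 - √(1 - α ^ 2)))) ^ (4 * m) := by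
    have h1 := affinity_pi (pairMass_nonneg hα0 hα1 b)
      (pairMass_nonneg hα0 hα1 (Function.update b i (!b i))) m
    have h2 := affinity_prod (p' := obsMass α b) (q' := obsMass α (Function.update b i (!b i)))
      (obsMass_nonneg hα0 hα1 b) (obsMass_nonneg hα0 hα1 (Function.update b i (!b i)))
    rw [affinity_obsMass hα0 hα1 hk] at h2
    unfold sampleMass
    rw [h1, show affinity (pairMass α b) (pairMass α (Function.update b i (!b i))) = _ from h2,
      ← sub_eq_add_neg, ← sq, ← pow_mul, ← pow_mul]
    congr 1
    ring
  rw [haff]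
  refine le_trans (le_of_eq ?_) (one_add_mul_le_pow (by linarith) _)
  push_cast
  ring

end Mass

/-! ### The distance-based error under the noisy star -/

/-- The expected loss of a pair at weighted distance `ρ` whose labels agree with probability
`(1 + r) / 2`. -/
noncomputable def expectedLoss (lam L U ρ r : ℝ) : ℝ :=
  (1 + r) / 2 * lossLU lam L U ρ true + (1 - r) / 2 * lossLU lam L U ρ false

section Loss

variable {lam L ρ r : ℝ}

lemma lossLU_nonneg (hlam : 0 ≤ lam) {U : ℝ} (Y : Bool) : 0 ≤ lossLU lam L U ρ Y := by
  unfold lossLU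
  split_ifs <;> exact le_min zero_le_one (mul_nonneg hlam (le_max_left _ _))

lemma lossLU_true_eq_one (hlam : 0 ≤ lam) (hL : lam * L = 2) (hρ : L / 2 ≤ ρ) :
    lossLU lam L 0 ρ true = 1 := by
  rw [lossLU, if_pos rfl, min_eq_left]
  calc 1 = lam * (L / 2) := by linarith
    _ ≤ lam * max 0 (ρ - 0) :=
      mul_le_mul_of_nonneg_left (by linarith [le_max_right 0 (ρ - 0)]) hlam

lemma lossLU_false_eq_one (hlam : 0 ≤ lam) (hL : lam * L = 2) (hρ : ρ ≤ L / 2) :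
    lossLU lam L 0 ρ false = 1 := by
  rw [lossLU, if_neg Bool.false_ne_true, min_eq_left]
  calc 1 = lam * (L / 2) := by linarith
    _ ≤ lam * max 0 (L - ρ) :=
      mul_le_mul_of_nonneg_left (by linarith [le_max_right 0 (L - ρ)]) hlam

/-- No distance beats the Bayes risk: the loss is `1` for at least one of the two values of
`Y`. -/
lemma le_expectedLoss (hlam : 0 ≤ lam) (hL : lam * L = 2) (hr : |r| ≤ 1) :
    (1 - |r|) / 2 ≤ expectedLoss lam L 0 ρ r := by
  have hr' := abs_le.1 hr
  have h1 := le_abs_self r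
  have h2 := neg_le_abs r
  unfold expectedLoss
  rcases le_total (L / 2) ρ with h | h
  · rw [lossLU_true_eq_one hlam hL h]
    nlinarith [lossLU_nonneg (L := L) (ρ := ρ) (U := 0) hlam false]
  · rw [lossLU_false_eq_one hlam hL h]
    nlinarith [lossLU_nonneg (L := L) (ρ := ρ) (U := 0) hlam true]

/-- The Bayes risk is attained by distance `0` for pairs that tend to agree, and by distance at
least `L` for pairs that tend to disagree. -/
lemma expectedLoss_eq (hlam : 0 ≤ lam) (hL : lam * L = 2) (hL0 : 0 ≤ L)
    (h : (0 ≤ r ∧ ρ = 0) ∨ (r ≤ 0 ∧ L ≤ ρ)) :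
    expectedLoss lam L 0 ρ r = (1 - |r|) / 2 := by
  rcases h with ⟨hr, rfl⟩ | ⟨hr, hρ⟩
  · rw [expectedLoss, lossLU_false_eq_one hlam hL (by linarith), abs_of_nonneg hr]
    simp [lossLU]
  · rw [expectedLoss, lossLU_true_eq_one hlam hL (by linarith), abs_of_nonpos hr]
    simp [lossLU, hρ]

/-- Being on the wrong side of `L / 2` costs at least `|r|`. -/
lemma le_expectedLoss_of_wrong_side (hlam : 0 ≤ lam) (hL : lam * L = 2) (hr : |r| ≤ 1)
    (h : (0 ≤ r ∧ L / 2 ≤ ρ) ∨ (r ≤ 0 ∧ ρ ≤ L / 2)) :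
    (1 + |r|) / 2 ≤ expectedLoss lam L 0 ρ r := by
  have hr' := abs_le.1 hr
  rcases h with ⟨hr, hρ⟩ | ⟨hr, hρ⟩
  · rw [expectedLoss, lossLU_true_eq_one hlam hL hρ, abs_of_nonneg hr]
    nlinarith [lossLU_nonneg (L := L) (ρ := ρ) (U := 0) hlam false]
  · rw [expectedLoss, lossLU_false_eq_one hlam hL hρ, abs_of_nonpos hr]
    nlinarith [lossLU_nonneg (L := L) (ρ := ρ) (U := 0) hlam true]

end Loss

lemma weightedDist_comm {D : ℕ} (M : Matrix (Fin D) (Fin D) ℝ) (x y : Space D) :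
    weightedDist M x y = weightedDist M y x := by
  rw [weightedDist, weightedDist, ← neg_sub y x, map_neg, norm_neg]

/-- The labelled observation at a labelled site, when the sites are placed at `y`. -/
def placeObs {k D : ℕ} (y : Option (Fin k) → Space D) (z : Option (Fin k) × Fin 2) : Obs D :=
  (y z.1, z.2)

/-- The distance-based error of `M` under the noisy star with sites placed at `y`. -/
noncomputable def starErr {k D : ℕ} (lam L U α : ℝ) (b : Fin k → Bool)
    (y : Option (Fin k) → Space D) (M : Matrix (Fin D) (Fin D) ℝ) : ℝ :=
  ∑ p, pairMass α b p * pairLoss lam L U M (Prod.map (placeObs y) (placeObs y) p)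

lemma starErr_eq_sum {k D : ℕ} (lam L U α : ℝ) (b : Fin k → Bool)
    (y : Option (Fin k) → Space D) (M : Matrix (Fin D) (Fin D) ℝ) :
    starErr lam L U α b y M = ∑ u, ∑ v, siteMass k u * siteMass k v *
      expectedLoss lam L U (weightedDist M (y u) (y v)) (labelMean α b u * labelMean α b v) := by
  simp only [starErr, Fintype.sum_prod_type]
  refine Finset.sum_congr rfl fun u _ => ?_
  rw [Finset.sum_comm]
  refine Finset.sum_congr rfl fun v _ => ?_
  simp only [Fin.sum_univ_two, pairMass, obsMass, pairLoss, placeObs, Prod.map, labelSign,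
    expectedLoss, if_pos, one_ne_zero, zero_ne_one, if_false, decide_true, decide_false]
  ring

section Star

variable {k D : ℕ} {lam L α : ℝ} {b : Fin k → Bool} {y : Option (Fin k) → Space D}
  {M : Matrix (Fin D) (Fin D) ℝ}

/-- The Bayes risk of the noisy star. -/
noncomputable def starBayesErr {k : ℕ} (α : ℝ) (b : Fin k → Bool) : ℝ :=
  ∑ u, ∑ v, siteMass k u * siteMass k v * ((1 - |labelMean α b u * labelMean α b v|) / 2)

lemma abs_labelMean_mul_le (hα0 : 0 ≤ α) (hα1 : α ≤ 1) (b : Fin k → Bool)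
    (u v : Option (Fin k)) : |labelMean α b u * labelMean α b v| ≤ 1 := by
  rw [abs_mul]
  exact mul_le_one₀ (abs_labelMean_le hα0 hα1 b u) (abs_nonneg _) (abs_labelMean_le hα0 hα1 b v)

/-- A metric that collapses each of the two sides of the star and separates them by at least `L`
is Bayes optimal. -/
lemma starErr_eq_starBayesErr (hlam : 0 ≤ lam) (hL : lam * L = 2) (hL0 : 0 ≤ L)
    (hα0 : 0 ≤ α)
    (h0 : ∀ u v, u.elim true b = v.elim true b → weightedDist M (y u) (y v) = 0)
    (h1 : ∀ u v, u.elim true b ≠ v.elim true b → L ≤ weightedDist M (y u) (y v)) :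
    starErr lam L 0 α b y M = starBayesErr α b := by
  rw [starErr_eq_sum, starBayesErr]
  refine Finset.sum_congr rfl fun u _ => Finset.sum_congr rfl fun v _ => ?_
  congr 1
  apply expectedLoss_eq hlam hL hL0
  have hsign (u : Option (Fin k)) : (u.elim true b = true ∧ 0 ≤ labelMean α b u) ∨
      (u.elim true b = false ∧ labelMean α b u ≤ 0) := by
    rcases u with _ | i
    · simp [labelMean]
    · cases hb : b i <;> simp [labelMean, hb, hα0]
  rcases hsign u with ⟨hu, hu'⟩ | ⟨hu, hu'⟩ <;> rcases hsign v with ⟨hv, hv'⟩ | ⟨hv, hv'⟩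
  · exact Or.inl ⟨mul_nonneg hu' hv', h0 u v (hu.trans hv.symm)⟩
  · exact Or.inr ⟨mul_nonpos_of_nonneg_of_nonpos hu' hv', h1 u v (by simp [hu, hv])⟩
  · exact Or.inr ⟨mul_nonpos_of_nonpos_of_nonneg hu' hv', h1 u v (by simp [hu, hv])⟩
  · exact Or.inl ⟨mul_nonneg_of_nonpos_of_nonpos hu' hv', h0 u v (hu.trans hv.symm)⟩

/-- The sign pattern that a metric predicts: site `i` goes to the side of the anchor iff its
distance to the anchor is less than `L / 2`. -/
noncomputable def predictedSide {k D : ℕ} (L : ℝ) (y : Option (Fin k) → Space D)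
    (M : Matrix (Fin D) (Fin D) ℝ) (i : Fin k) : Bool :=
  decide (weightedDist M (y none) (y (some i)) < L / 2)

/-- Every wrongly predicted side costs `α` on the pairs formed by its site and the anchor. -/
lemma le_starErr_sub (hlam : 0 ≤ lam) (hL : lam * L = 2) (hα0 : 0 ≤ α) (hα1 : α ≤ 1) :
    4 * α / (9 * k) * (Finset.univ.filter fun i => predictedSide L y M i ≠ b i).card
      ≤ starErr lam L 0 α b y M - starBayesErr α b := by
  set f : Option (Fin k) → Option (Fin k) → ℝ := fun u v => siteMass k u * siteMass k v *
    (expectedLoss lam L 0 (weightedDist M (y u) (y v)) (labelMean α b u * labelMean α b v)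
      - (1 - |labelMean α b u * labelMean α b v|) / 2) with hf
  have hsum : starErr lam L 0 α b y M - starBayesErr α b = ∑ u, ∑ v, f u v := by
    rw [starErr_eq_sum, starBayesErr, ← Finset.sum_sub_distrib]
    refine Finset.sum_congr rfl fun u _ => ?_
    rw [← Finset.sum_sub_distrib]
    exact Finset.sum_congr rfl fun v _ => (mul_sub _ _ _).symm
  have hf0 (u v) : 0 ≤ f u v :=
    mul_nonneg (mul_nonneg (siteMass_nonneg u) (siteMass_nonneg v))
      (sub_nonneg.2 (le_expectedLoss hlam hL (abs_labelMean_mul_le hα0 hα1 b u v)))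
  have hcomm (u v) : f u v = f v u := by
    simp only [hf]
    rw [weightedDist_comm, mul_comm (siteMass k u), mul_comm (labelMean α b u)]
  have hwrong (i : Fin k) :
      2 * α / (9 * k) * (if predictedSide L y M i ≠ b i then 1 else 0) ≤ f none (some i) := by
    split_ifs with hi
    · have habs : |labelMean α b none * labelMean α b (some i)| = α := by
        simp only [labelMean, one_mul]
        split_ifs <;> simp [abs_of_nonneg hα0]
      have hle := le_expectedLoss_of_wrong_side (L := L)
        (ρ := weightedDist M (y none) (y (some i))) hlam hL
        (abs_labelMean_mul_le hα0 hα1 b none (some i)) (by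
          cases hb : b i
          · right
            simp only [predictedSide, hb, ne_eq, decide_eq_false_iff_not, not_not] at hi
            simp [labelMean, hb, hα0, hi.le]
          · left
            simp only [predictedSide, hb, ne_eq, decide_eq_true_eq, not_lt] at hi
            simp [labelMean, hb, hα0, hi])
      rw [habs] at hle
      simp only [hf, habs, siteMass]
      calc 2 * α / (9 * k) * 1 = 2 / 3 * (1 / (3 * k)) * α := by ring
        _ ≤ _ := mul_le_mul_of_nonneg_left (by linarith) (by positivity)
    · rw [mul_zero]
      exact hf0 _ _
  calc 4 * α / (9 * k) * ((Finset.univ.filter fun i => predictedSide L y M i ≠ b i).card : ℝ)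
      = 2 * ∑ i, 2 * α / (9 * k) * (if predictedSide L y M i ≠ b i then 1 else 0) := by
        rw [← Finset.mul_sum, Finset.sum_boole]
        ring
    _ ≤ 2 * ∑ i, f none (some i) := by
        gcongr with i
        exact hwrong i
    _ = ∑ i, f none (some i) + ∑ i, f (some i) none := by
        rw [two_mul, Finset.sum_congr rfl fun i _ => hcomm (some i) none]
    _ ≤ ∑ u, ∑ v, f u v := by
        simp only [Fintype.sum_option, Finset.sum_add_distrib]
        have h1 := hf0 none none
        have h2 : 0 ≤ ∑ i, ∑ j, f (some i) (some j) :=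
          Finset.sum_nonneg fun i _ => Finset.sum_nonneg fun j _ => hf0 _ _
        linarith
    _ = _ := hsum.symm

end Star

/-! ### Finitely supported laws -/

lemma measurable_pairLoss {D : ℕ} (lam L U : ℝ) (M : Matrix (Fin D) (Fin D) ℝ) :
    Measurable (pairLoss lam L U M) := by
  have hd : Measurable fun p : ObsPair D => weightedDist M p.1.1 p.2.1 := by
    unfold weightedDist
    fun_prop
  have hset : MeasurableSet {p : ObsPair D | p.1.2 = p.2.2} :=
    measurableSet_eq_fun (by fun_prop) (by fun_prop)
  have heq : pairLoss lam L U M = fun p : ObsPair D => if p.1.2 = p.2.2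
      then min 1 (lam * max 0 (weightedDist M p.1.1 p.2.1 - U))
      else min 1 (lam * max 0 (L - weightedDist M p.1.1 p.2.1)) := by
    funext p
    simp [pairLoss, lossLU]
  rw [heq]
  refine Measurable.ite hset ?_ ?_ <;> fun_prop

lemma distErr_toMeasure_map {T : Type*} [Fintype T] {D : ℕ} (lam L U : ℝ)
    (M : Matrix (Fin D) (Fin D) ℝ) (p : PMF T) (f : T → Obs D) :
    distErr lam L U M (p.map f).toMeasure
      = ∑ z : T × T, (p z.1).toReal * (p z.2).toReal * pairLoss lam L U M (Prod.map f f z) := by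
  let _ : MeasurableSpace T := ⊤
  have hf : Measurable f := measurable_from_top
  rw [distErr, ← PMF.toMeasure_map f p hf, Measure.map_prod_map _ _ hf hf,
    integral_map (by fun_prop) (measurable_pairLoss lam L U M).aestronglyMeasurable,
    integral_fintype .of_finite]
  refine Finset.sum_congr rfl fun z _ => ?_
  rw [measureReal_def, ← Prod.mk.eta (p := z), ← Set.singleton_prod_singleton, Measure.prod_prod,
    PMF.toMeasure_apply_singleton _ _ (measurableSet_singleton _),
    PMF.toMeasure_apply_singleton _ _ (measurableSet_singleton _), ENNReal.toReal_mul,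
    smul_eq_mul]

/-- The law of a paired sample from a finitely supported law. The set `E` is arbitrary, as nothing
is known on the measurability of the algorithm. -/
lemma le_sampleLaw_toMeasure_map {T : Type*} [Fintype T] {D m : ℕ} (p : PMF T) (f : T → Obs D)
    (E : Set (PairedSample D m)) [DecidablePred (· ∈ E)] :
    ∑ S : Fin m → T × T, (∏ j, (p (S j).1).toReal * (p (S j).2).toReal) *
        (if (fun j => Prod.map f f (S j)) ∈ E then 1 else 0)
      ≤ (sampleLaw m (p.map f).toMeasure).real E := by
  let _ : MeasurableSpace T := ⊤
  have hf : Measurable f := measurable_from_top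
  have hlaw : sampleLaw m (p.map f).toMeasure
      = (Measure.pi fun _ : Fin m => p.toMeasure.prod p.toMeasure).map
          fun S j => Prod.map f f (S j) := by
    rw [sampleLaw, ← PMF.toMeasure_map f p hf, Measure.map_prod_map _ _ hf hf,
      Measure.pi_map_pi fun _ => by fun_prop]
  have hmeas : Measurable fun (S : Fin m → T × T) j => Prod.map f f (S j) := by fun_prop
  have : IsProbabilityMeasure (sampleLaw m (p.map f).toMeasure) := by
    rw [hlaw]
    exact Measure.isProbabilityMeasure_map hmeas.aemeasurable
  classical
  calc _ = ∑ S ∈ Finset.univ.filter fun S : Fin m → T × T => (fun j => Prod.map f f (S j)) ∈ E,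
        (Measure.pi fun _ : Fin m => p.toMeasure.prod p.toMeasure).real {S} := by
        rw [Finset.sum_filter]
        refine Finset.sum_congr rfl fun S _ => ?_
        rw [mul_ite, mul_one, mul_zero, measureReal_def, Measure.pi_singleton,
          ENNReal.toReal_prod]
        congr 1
        refine Finset.prod_congr rfl fun j _ => ?_
        rw [← Prod.mk.eta (p := S j), ← Set.singleton_prod_singleton, Measure.prod_prod,
          PMF.toMeasure_apply_singleton _ _ (measurableSet_singleton _),
          PMF.toMeasure_apply_singleton _ _ (measurableSet_singleton _), ENNReal.toReal_mul]
    _ = (Measure.pi fun _ : Fin m => p.toMeasure.prod p.toMeasure).real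
          ((fun (S : Fin m → T × T) j => Prod.map f f (S j)) ⁻¹' E) := by
        rw [sum_measureReal_singleton]
        congr 1
        ext S
        simp
    _ ≤ _ := by
        refine ENNReal.toReal_mono (measure_ne_top _ _) ?_
        rw [hlaw]
        exact Measure.le_map_apply hmeas.aemeasurable E

/-- The law of a labelled site of the noisy star. -/
noncomputable def starPMF {k : ℕ} {α : ℝ} (hk : 0 < k) (hα0 : 0 ≤ α) (hα1 : α ≤ 1)
    (b : Fin k → Bool) : PMF (Option (Fin k) × Fin 2) :=
  PMF.ofFintype (fun z => ENNReal.ofReal (obsMass α b z)) (by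
    rw [← ENNReal.ofReal_sum_of_nonneg fun z _ => obsMass_nonneg hα0 hα1 b z, sum_obsMass hk,
      ENNReal.ofReal_one])

lemma toReal_starPMF {k : ℕ} {α : ℝ} (hk : 0 < k) (hα0 : 0 ≤ α) (hα1 : α ≤ 1)
    (b : Fin k → Bool) (z : Option (Fin k) × Fin 2) :
    (starPMF hk hα0 hα1 b z).toReal = obsMass α b z := by
  rw [starPMF, PMF.ofFintype_apply, ENNReal.toReal_ofReal (obsMass_nonneg hα0 hα1 b z)]

/-! ### Constants -/

/-- The sample size bound makes the signs with bias `9 ε` hard to tell apart. -/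
lemma information_le {k m : ℕ} (hk : 0 < k) {ε : ℝ} (hε0 : 0 < ε) (hε : ε < 1 / 64)
    (hm : (m : ℝ) ≤ ((k : ℝ) + 2) / (512 * ε ^ 2)) :
    4 * m * (1 / (3 * k) * (1 - √(1 - (9 * ε) ^ 2))) ≤ 0.1076 * (k + 2) / k := by
  have hk0 : (0 : ℝ) < k := by exact_mod_cast hk
  have hsqrt : 1 - √(1 - (9 * ε) ^ 2) ≤ 0.51 * (9 * ε) ^ 2 := by
    have hα : (9 * ε) ^ 2 ≤ 0.02 := by nlinarith
    have : 1 - 0.51 * (9 * ε) ^ 2 ≤ √(1 - (9 * ε) ^ 2) := by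
      apply Real.le_sqrt_of_sq_le
      nlinarith [sq_nonneg (9 * ε)]
    linarith
  rw [le_div_iff₀ (by positivity)] at hm
  rw [le_div_iff₀ hk0]
  calc 4 * m * (1 / (3 * k) * (1 - √(1 - (9 * ε) ^ 2))) * k
      ≤ 4 * m * (1 / (3 * k) * (0.51 * (9 * ε) ^ 2)) * k := by gcongr
    _ = (4 * 0.51 * 27 / 512) * (m * (512 * ε ^ 2)) := by
        field_simp
        ring
    _ ≤ (4 * 0.51 * 27 / 512) * (k + 2) := by gcongr
    _ ≤ 0.1076 * (k + 2) := by nlinarith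

/-- Many errors on average force more than `k / 4` errors with probability at least `1 / 64`. For
`k = 1` the number of errors is `0` or `1`; otherwise this is Markov's inequality. -/
lemma le_prob_of_expected_errors {Ω : Type*} [Fintype Ω] {k : ℕ} (hk : 0 < k) {P : Ω → ℝ}
    (hP : ∀ ω, 0 ≤ P ω) (hP1 : ∑ ω, P ω = 1) {N : Ω → ℕ} (hN : ∀ ω, N ω ≤ k) {q : ℝ}
    (hq1 : 1 / 64 ≤ q) (hq : 2 ≤ k → 17 / 64 ≤ q) (h : k * q ≤ ∑ ω, P ω * N ω) :
    1 / 64 ≤ ∑ ω, P ω * (if (k : ℝ) / 4 < N ω then 1 else 0) := by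
  rcases (Nat.succ_le_of_lt hk).eq_or_lt with hk1 | hk2
  · have hk1 : k = 1 := hk1.symm
    subst hk1
    refine hq1.trans (le_trans (by simpa using h) (Finset.sum_le_sum fun ω _ => ?_))
    refine mul_le_mul_of_nonneg_left ?_ (hP ω)
    rcases Nat.le_one_iff_eq_zero_or_eq_one.1 (hN ω) with h0 | h0 <;> norm_num [h0]
  · have hk0 : (0 : ℝ) < k := by exact_mod_cast hk
    have hle : ∑ ω, P ω * N ω
        ≤ ∑ ω, (P ω * (k / 4) + k * (P ω * (if (k : ℝ) / 4 < N ω then 1 else 0))) := by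
      refine Finset.sum_le_sum fun ω _ => ?_
      have hNk : (N ω : ℝ) ≤ k := by exact_mod_cast hN ω
      split_ifs with hω
      · nlinarith [hP ω]
      · rw [mul_zero, mul_zero, add_zero]
        exact mul_le_mul_of_nonneg_left (not_lt.1 hω) (hP ω)
    rw [Finset.sum_add_distrib, ← Finset.sum_mul, hP1, ← Finset.mul_sum] at hle
    have := hq hk2
    nlinarith

/-- For any predictor of signs of bias `9 ε` from a sample of the given size, some sign pattern
makes it err in more than a quarter of the signs with probability at least `1 / 64`. -/
lemma exists_le_prob_errors {k m : ℕ} (hk : 0 < k) {ε : ℝ} (hε0 : 0 < ε) (hε : ε < 1 / 64)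
    (hm : (m : ℝ) ≤ ((k : ℝ) + 2) / (512 * ε ^ 2))
    (g : (Fin m → (Option (Fin k) × Fin 2) × (Option (Fin k) × Fin 2)) → Fin k → Bool) :
    ∃ b, 1 / 64 ≤ ∑ S, sampleMass (9 * ε) b S *
      (if (k : ℝ) / 4 < (Finset.univ.filter fun i => g S i ≠ b i).card then 1 else 0) := by
  have hk0 : (1 : ℝ) ≤ k := by exact_mod_cast hk
  have hα0 : 0 ≤ 9 * ε := by positivity
  have hα1 : 9 * ε ≤ 1 := by linarith
  have hinfo := information_le hk hε0 hε hm
  -- `0.1076 (k + 2) / k` is at most `0.3228` for `k = 1` and at most `0.2152` for `k ≥ 2`.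
  obtain ⟨τ, hτ0, hτ, hq1, hq⟩ : ∃ τ : ℝ, 0 ≤ τ ∧ 0.1076 * (k + 2) / k ≤ τ ^ 2 ∧
      1 / 64 ≤ (1 - τ) / 2 ∧ (2 ≤ k → 17 / 64 ≤ (1 - τ) / 2) := by
    rcases (Nat.succ_le_of_lt hk).eq_or_lt with hk1 | hk2
    · have hk1 : k = 1 := hk1.symm
      subst hk1
      refine ⟨0.57, ?_, ?_, ?_, fun h => absurd h ?_⟩ <;> norm_num
    · have hk2' : (2 : ℝ) ≤ k := by exact_mod_cast hk2
      refine ⟨0.465, by norm_num, ?_, by norm_num, fun _ => by norm_num⟩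
      rw [div_le_iff₀ (by positivity)]
      norm_num
      linarith
  obtain ⟨b, hb⟩ := exists_le_expected_errors (P := fun b => sampleMass (m := m) (9 * ε) b) hτ0
    (fun b => sampleMass_nonneg hα0 hα1 b) (fun b => sum_sampleMass hk m b)
    (fun b i => le_trans (by linarith) (le_affinity_sampleMass_sq hα0 hα1 hk m b i)) g
  refine ⟨b, le_prob_of_expected_errors hk (sampleMass_nonneg hα0 hα1 b) (sum_sampleMass hk m b)
    (fun S => ?_) hq1 hq hb⟩
  exact (Finset.card_le_univ _).trans_eq (Fintype.card_fin k)

/-! ### The lower bound -/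

/-- The vertex of the simplex at which a site is placed: the anchor at the first vertex, and no
site at the last one. -/
def siteVertex {k : ℕ} (v : Option (Fin k)) : Fin (k + 1 + 1) :=
  v.elim 0 fun i => i.succ.castSucc

lemma siteVertex_injective {k : ℕ} : Function.Injective (siteVertex (k := k)) := by
  rintro (_ | i) (_ | j) h
  · rfl
  · simp [siteVertex, Fin.ext_iff] at h
  · simp [siteVertex, Fin.ext_iff] at h
  · simpa [siteVertex, Fin.ext_iff] using h

lemma siteVertex_ne_last {k : ℕ} (v : Option (Fin k)) : siteVertex v ≠ Fin.last (k + 1) := by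
  rcases v with _ | i
  · simp [siteVertex, Fin.ext_iff]
  · exact (Fin.castSucc_lt_last _).ne

/-- Since the last vertex carries no mass, both sides of the star are proper faces of the simplex,
for every sign pattern, and separating them is Bayes optimal. -/
lemma exists_starErr_eq_starBayesErr {k : ℕ} {x : Fin (k + 1 + 1) → Space (k + 1)}
    (hx : ∀ i j, inner ℝ (x i) (x j) = if i = j then 1 else -1 / ((k + 1 : ℕ) : ℝ))
    {α : ℝ} (hα0 : 0 ≤ α) (b : Fin k → Bool) :
    ∃ M ∈ metrics (k + 1), starErr (((k + 1 : ℕ) : ℝ) / 2) (4 / ((k + 1 : ℕ) : ℝ)) 0 α b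
      (x ∘ siteVertex) M = starBayesErr α b := by
  classical
  set G : Finset (Fin (k + 1 + 1)) :=
    (Finset.univ.filter fun v : Option (Fin k) => v.elim true b = true).image siteVertex with hG
  have hmem (v : Option (Fin k)) : siteVertex v ∈ G ↔ v.elim true b = true := by
    simp [hG, siteVertex_injective.eq_iff]
  obtain ⟨M, hM, h0, h1⟩ := exists_separating_metric k.succ_pos hx (G := G)
    ⟨siteVertex none, (hmem none).2 rfl⟩ (fun h => by
      have hlast := Finset.eq_univ_iff_forall.1 h (Fin.last _)
      obtain ⟨v, -, hv⟩ := Finset.mem_image.1 hlast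
      exact siteVertex_ne_last v hv)
  refine ⟨M, hM, starErr_eq_starBayesErr (by positivity) ?_ (by positivity) hα0
    (fun u v huv => h0 _ _ ?_) fun u v huv => h1 _ _ ?_⟩
  · have : ((k + 1 : ℕ) : ℝ) ≠ 0 := by positivity
    field_simp
    norm_num
  · rw [hmem, hmem, huv]
  · rw [hmem, hmem, Bool.coe_iff_coe]
    exact huv

end MetricLearning

theorem lemma2 (D : ℕ) (hD : 2 ≤ D) :
    ∃ lam L U : ℝ, 0 ≤ lam ∧ 0 ≤ U ∧ U < L ∧
    -- the vertices of a regular simplex inscribed in the unit sphere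
    ∃ Δ : Affine.Simplex ℝ (MetricLearning.Space D) D,
      Δ.Equilateral ∧ (∀ i, ‖Δ.points i‖ = 1) ∧
      ∀ (m : ℕ) (A : MetricLearning.PairedSample D m → Matrix (Fin D) (Fin D) ℝ),
        MetricLearning.IsEmpiricalMinimizer lam L U A →
        ∀ ε δ : ℝ, 0 < ε → ε < 1 / 64 → 0 < δ → δ < 1 / 64 →
          ∃ 𝒟 : MeasureTheory.Measure (MetricLearning.Obs D),
            MeasureTheory.IsProbabilityMeasure 𝒟 ∧
            MetricLearning.HasBoundedSupport 𝒟 ∧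
            𝒟 {z | z.1 ∉ Set.range Δ.points} = 0 ∧
            ∃ Mstar : Matrix (Fin D) (Fin D) ℝ,
              MetricLearning.IsOptimalMetric lam L U 𝒟 Mstar ∧
              ((m : ℝ) ≤ ((D : ℝ) + 1) / (512 * ε ^ 2) →
                δ < (MetricLearning.sampleLaw m 𝒟).real
                  {S | ε < MetricLearning.distErr lam L U (A S) 𝒟
                      - MetricLearning.distErr lam L U Mstar 𝒟}) := by
  open MetricLearning in
  classical
  obtain ⟨k, rfl⟩ : ∃ k, D = k + 1 := ⟨D - 1, by omega⟩
  have hk : 0 < k := by omega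
  have hk0 : (0 : ℝ) < k := by exact_mod_cast hk
  obtain ⟨x, hx⟩ := exists_inner_eq (k + 1) k.succ_pos
  have hlam : (0 : ℝ) ≤ ((k + 1 : ℕ) : ℝ) / 2 := by positivity
  have hL : ((k + 1 : ℕ) : ℝ) / 2 * (4 / ((k + 1 : ℕ) : ℝ)) = 2 := by
    have : ((k + 1 : ℕ) : ℝ) ≠ 0 := by positivity
    field_simp
    norm_num
  have hnorm (i) : ‖x i‖ = 1 := by
    rw [norm_eq_sqrt_real_inner, hx, if_pos rfl, Real.sqrt_one]
  refine ⟨((k + 1 : ℕ) : ℝ) / 2, 4 / ((k + 1 : ℕ) : ℝ), 0, hlam, le_rfl, by positivity,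
    ⟨x, affineIndependent_of_inner_eq hx⟩, ⟨√(2 + 2 / ((k + 1 : ℕ) : ℝ)), fun i j hij => ?_⟩,
    hnorm, fun m A _ ε δ hε0 hε _ hδ => ?_⟩
  · rw [← dist_sq_of_inner_eq hx hij, Real.sqrt_sq dist_nonneg]
  set y : Option (Fin k) → Space (k + 1) := x ∘ siteVertex with hy
  have hα0 : 0 ≤ 9 * ε := by positivity
  have hα1 : 9 * ε ≤ 1 := by linarith
  -- The hard sign pattern for `A`; any pattern will do for larger samples.
  obtain ⟨b, hb⟩ : ∃ b : Fin k → Bool, (m : ℝ) ≤ (((k + 1 : ℕ) : ℝ) + 1) / (512 * ε ^ 2) →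
      1 / 64 ≤ ∑ S : Fin m → _, sampleMass (9 * ε) b S *
        (if (k : ℝ) / 4 < (Finset.univ.filter fun i =>
          predictedSide (4 / ((k + 1 : ℕ) : ℝ)) y
            (A fun j => Prod.map (placeObs y) (placeObs y) (S j)) i ≠ b i).card
        then 1 else 0) := by
    by_cases hm : (m : ℝ) ≤ (((k + 1 : ℕ) : ℝ) + 1) / (512 * ε ^ 2)
    · obtain ⟨b, hb⟩ := exists_le_prob_errors hk hε0 hε
        (hm.trans_eq (by push_cast; ring)) fun S => predictedSide (4 / ((k + 1 : ℕ) : ℝ)) y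
          (A fun j => Prod.map (placeObs y) (placeObs y) (S j))
      exact ⟨b, fun _ => hb⟩
    · exact ⟨fun _ => true, fun h => absurd h hm⟩
  obtain ⟨Mstar, hMstar, hopt⟩ := exists_starErr_eq_starBayesErr hx hα0 b
  set p := starPMF hk hα0 hα1 b with hp
  have herr (M) : distErr (((k + 1 : ℕ) : ℝ) / 2) (4 / ((k + 1 : ℕ) : ℝ)) 0 M
      (p.map (placeObs y)).toMeasure
        = starErr (((k + 1 : ℕ) : ℝ) / 2) (4 / ((k + 1 : ℕ) : ℝ)) 0 (9 * ε) b y M := by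
    simp only [distErr_toMeasure_map, hp, toReal_starPMF, starErr, pairMass]
  have hexcess (M) := le_starErr_sub (b := b) (y := y) (M := M) hlam hL hα0 hα1
  have hrange : (p.map (placeObs y)).toMeasure {z | z.1 ∉ Set.range x} = 0 := by
    rw [PMF.toMeasure_apply_eq_zero_iff]
    · rw [Set.disjoint_left]
      intro z hz
      rw [PMF.support_map] at hz
      obtain ⟨t, -, rfl⟩ := hz
      exact fun h => h ⟨siteVertex t.1, rfl⟩
    · exact (measurable_fst (Set.finite_range x).measurableSet).compl
  refine ⟨(p.map (placeObs y)).toMeasure, inferInstance, ⟨1, ?_⟩, hrange, Mstar,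
    ⟨hMstar, fun M _ => ?_⟩, fun hm => ?_⟩
  · rw [ae_iff]
    refine measure_mono_null (fun z hz => ?_) hrange
    rintro ⟨i, hi⟩
    exact hz (by rw [← hi, hnorm])
  · rw [herr, herr, hopt]
    exact sub_nonneg.1 (le_trans (by positivity) (hexcess M))
  · refine hδ.trans_le ((hb hm).trans (le_trans ?_ (le_sampleLaw_toMeasure_map p (placeObs y) _)))
    refine Finset.sum_le_sum fun S _ => ?_
    have hmass : ∏ j, (p (S j).1).toReal * (p (S j).2).toReal = sampleMass (9 * ε) b S := by
      simp only [hp, toReal_starPMF, sampleMass, pairMass]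
    rw [hmass]
    refine mul_le_mul_of_nonneg_left ?_ (sampleMass_nonneg hα0 hα1 b S)
    split_ifs with h1 h2 h2
    · exact le_rfl
    · refine absurd ?_ h2
      change ε < _
      rw [herr, herr, hopt]
      -- each wrong side costs `4 (9 ε) / (9 k) = 4 ε / k`
      refine lt_of_lt_of_le ?_ (hexcess _)
      calc ε = 4 * (9 * ε) / (9 * k) * (k / 4) := by
            field_simp
        _ < _ := mul_lt_mul_of_pos_left h1 (by positivity)
    · exact zero_le_one
    · exact le_rfl
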